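/- Let $G$ be a real 4-dimensional Lie group with Lie algebra $\mathfrak g$, and let $(g,J,\Omega)$ be a left-invariant almost Kähler structure on $G$: that is, $g$ is a left-invariant Riemannian metric, $J$ a left-invariant almost complex structure, and $\Omega(X,Y)=g(JX,Y)$ a closed 2-form. Suppose that the structure is strictly almost Kähler, i.e. $J$ is not integrable (its Nijenhuis tensor does not vanish identically), and that the Ricci tensor $\rho$ of $g$ is $J$-invariant, i.e. $\rho(JX,JY)=\rho(X,Y)$ for all vector fields $X,Y$. Then $\mathfrak g$ is isomorphic to the Lie algebra $\mathfrak g_{4,9}(\tfrac12)$, i.e. the Lie algebra with a basis $f_1,\dots,f_4$ whose dual basis $f^1,\dots,f^4$ satisfies $$df^1=0,\qquad df^2=\tfrac12 f^1\wedge f^2,\qquad df^3=-f^1\wedge f^3,\qquad df^4=-\tfrac12 f^1\wedge f^4-f^2\wedge f^3$$ (where $d\beta(X,Y)=-\beta([X,Y])$ for a left-invariant 1-form $\beta$). Moreover, the isomorphism can be chosen so that, for some constant $c>0$, $$g=c\,\bigl((f^1)^2+(f^2)^2+(f^3)^2+(f^4)^2\bigr),$$ i.e. $g$ is homothetic to the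 left-invariant metric for which $f_1,\dots,f_4$ is orthonormal. -/

import Mathlib

open scoped Manifold ContDiff
open Bundle VectorField

noncomputable section

section Geometry

variable {E : Type*} [NormedAddCommGroup E] [NormedSpace ℝ E]
  {H : Type*} [TopologicalSpace H] {I : ModelWithCorners ℝ E H}
  {M : Type*} [TopologicalSpace M] [ChartedSpace H M] [IsManifold I ∞ M]

/-- A (not necessarily smooth) vector field on `M`. -/
abbrev VField (I : ModelWithCorners ℝ E H) (M : Type*) [TopologicalSpace M]
    [ChartedSpace H M] : Type _ :=
  (x : M) → TangentSpace I x

/-- Smoothness (`C^∞`) of a vector field. -/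
def VField.IsSmooth (X : VField I M) : Prop :=
  ContMDiff I I.tangent ∞ (fun x ↦ (⟨x, X x⟩ : TangentBundle I M))

/-- The Lie derivative `X f` of a real function `f` along a vector field `X`. -/
def VField.deriv (X : VField I M) (f : M → ℝ) : M → ℝ :=
  fun x ↦ mvfderiv I f x (X x)

/-- The exterior derivative of a 2-form `η`, evaluated on three vector fields:
`dη(X,Y,Z) = X η(Y,Z) + Y η(Z,X) + Z η(X,Y) - η([X,Y],Z) - η([Y,Z],X) - η([Z,X],Y)`. -/
def extDerivTwoForm (η : (x : M) → TangentSpace I x → TangentSpace I x → ℝ)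
    (X Y Z : VField I M) (x : M) : ℝ :=
  X.deriv (fun y ↦ η y (Y y) (Z y)) x
    + Y.deriv (fun y ↦ η y (Z y) (X y)) x
    + Z.deriv (fun y ↦ η y (X y) (Y y)) x
    - η x (mlieBracket I X Y x) (Z x)
    - η x (mlieBracket I Y Z x) (X x)
    - η x (mlieBracket I Z X x) (Y x)

/-- The Nijenhuis tensor of a field of endomorphisms `J`, evaluated on two vector fields:
`[JX,JY] - J[JX,Y] - J[X,JY] - [X,Y]`. -/
def nijenhuis (J : (x : M) → TangentSpace I x →L[ℝ] TangentSpace I x)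
    (X Y : VField I M) (x : M) : TangentSpace I x :=
  mlieBracket I (fun y ↦ J y (X y)) (fun y ↦ J y (Y y)) x
    - J x (mlieBracket I (fun y ↦ J y (X y)) Y x)
    - J x (mlieBracket I X (fun y ↦ J y (Y y)) x)
    - mlieBracket I X Y x

/-- The curvature `R(X,Y)Z = ∇_X ∇_Y Z - ∇_Y ∇_X Z - ∇_{[X,Y]} Z` of an affine connection. -/
def curvatureField (D : CovariantDerivative I E (TangentSpace I : M → Type _))
    (X Y Z : VField I M) (x : M) : TangentSpace I x :=
  D (fun y ↦ D Z y (Y y)) x (X x) - D (fun y ↦ D Z y (X y)) x (Y x)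
    - D Z x (mlieBracket I X Y x)

variable (I M) in
/-- An almost Kähler structure `(g, J, Ω)` on a manifold. -/
structure AlmostKahlerStructure where
  /-- The Riemannian metric. -/
  g : ContMDiffRiemannianMetric I ∞ E (TangentSpace I : M → Type _)
  /-- The almost complex structure. -/
  J : (x : M) → TangentSpace I x →L[ℝ] TangentSpace I x
  /-- The symplectic form. -/
  Ω : (x : M) → TangentSpace I x → TangentSpace I x → ℝ
  J_smooth : ContMDiff I (I.prod 𝓘(ℝ, E →L[ℝ] E)) ∞
    (fun x ↦ TotalSpace.mk' (E →L[ℝ] E) (E := fun x : M ↦ TangentSpace I x →L[ℝ] TangentSpace I x)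
      x (J x))
  J_sq : ∀ (x : M) (v : TangentSpace I x), J x (J x v) = -v
  /-- Compatibility `Ω(X,Y) = g(JX,Y)`; in particular `Ω` is smooth, bilinear, nondegenerate. -/
  compat : ∀ (x : M) (v w : TangentSpace I x), Ω x v w = g.inner x (J x v) w
  alternating : ∀ (x : M) (v : TangentSpace I x), Ω x v v = 0
  closed : ∀ X Y Z : VField I M, X.IsSmooth → Y.IsSmooth → Z.IsSmooth →
    ∀ x : M, extDerivTwoForm Ω X Y Z x = 0

/-- The almost complex structure is integrable: its Nijenhuis tensor vanishes identically. -/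
def AlmostKahlerStructure.IsIntegrable (S : AlmostKahlerStructure I M) : Prop :=
  ∀ X Y : VField I M, X.IsSmooth → Y.IsSmooth → ∀ x : M, nijenhuis S.J X Y x = 0

/-- Strictly almost Kähler: the almost complex structure is not integrable. -/
def AlmostKahlerStructure.IsStrict (S : AlmostKahlerStructure I M) : Prop :=
  ¬ S.IsIntegrable

end Geometry

section LeviCivita

variable {E : Type*} [NormedAddCommGroup E] [NormedSpace ℝ E]
  [FiniteDimensional ℝ E] [CompleteSpace E]
  {H : Type*} [TopologicalSpace H] {I : ModelWithCorners ℝ E H}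
  {M : Type*} [TopologicalSpace M] [ChartedSpace H M] [IsManifold I ∞ M]

/-- `D` is the Levi-Civita connection of the Riemannian metric `g`:
it is torsion free and `X g(Y,Z) = g(∇_X Y,Z) + g(Y,∇_X Z)`. -/
structure IsLeviCivita (g : ContMDiffRiemannianMetric I ∞ E (TangentSpace I : M → Type _))
    (D : CovariantDerivative I E (TangentSpace I : M → Type _)) : Prop where
  torsion_free : D.torsion = 0
  metric : ∀ X Y Z : VField I M, X.IsSmooth → Y.IsSmooth → Z.IsSmooth → ∀ x : M,
    X.deriv (fun y ↦ g.inner y (Y y) (Z y)) x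
      = g.inner x (D Y x (X x)) (Z x) + g.inner x (Y x) (D Z x (X x))

end LeviCivita

section Group

variable {E : Type*} [NormedAddCommGroup E] [NormedSpace ℝ E]
  {H : Type*} [TopologicalSpace H] {I : ModelWithCorners ℝ E H}
  {G : Type*} [TopologicalSpace G] [ChartedSpace H G] [Group G] [LieGroup I ∞ G]

/-- A smooth Lie group has the regularity for which its Lie algebra is set up. -/
instance lieGroup_minSmoothness : LieGroup I (minSmoothness ℝ 3) G :=
  LieGroup.of_le (m := minSmoothness ℝ 3) (n := ∞) (by
    rw [minSmoothness_of_isRCLikeNormedField]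
    exact ENat.LEInfty.out)

/-- The left-invariant vector field on `G` whose value at `x` is `u`. -/
def leftExtend (x : G) (u : TangentSpace I x) : VField I G :=
  mulInvariantVectorField
    ((mfderiv I I (fun y : G ↦ x⁻¹ * y) x u : TangentSpace I (x⁻¹ * x)) : GroupLieAlgebra I G)

theorem leftExtend_apply_self (x : G) (u : TangentSpace I x) : leftExtend x u x = u := by
  have hd (a y : G) : MDifferentiableAt I I (fun z : G ↦ a * z) y :=
    (contMDiff_mul_left (I := I) (n := ∞) (a := a)).mdifferentiableAt (by simp)
  have key : mfderiv I I ((fun z : G ↦ x * z) ∘ (fun z : G ↦ x⁻¹ * z)) x u = u := by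
    have hid : (fun z : G ↦ x * z) ∘ (fun z : G ↦ x⁻¹ * z) = id := by ext z; simp
    rw [hid, mfderiv_id]
    rfl
  rw [mfderiv_comp (I' := I) x (hd x _) (hd x⁻¹ x)] at key
  have h1 : (x⁻¹ * x : G) = 1 := inv_mul_cancel x
  simp only [leftExtend, mulInvariantVectorField]
  rw [← h1]
  exact key

theorem mulInvariantVectorField_isSmooth (v : GroupLieAlgebra I G) :
    VField.IsSmooth (mulInvariantVectorField v : VField I G) := by
  let fg : G → TangentBundle I G := fun g ↦ TotalSpace.mk' E g 0
  have sfg : ContMDiff I I.tangent ∞ fg := contMDiff_zeroSection _ _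
  let fv : G → TangentBundle I G := fun _ ↦ TotalSpace.mk' E 1 v
  have sfv : ContMDiff I I.tangent ∞ fv := contMDiff_const
  let F₁ : G → (TangentBundle I G × TangentBundle I G) := fun g ↦ (fg g, fv g)
  have S₁ : ContMDiff I (I.tangent.prod I.tangent) ∞ F₁ := sfg.prodMk sfv
  let F₂ : (TangentBundle I G × TangentBundle I G) → TangentBundle (I.prod I) (G × G) :=
    (equivTangentBundleProd I G I G).symm
  have S₂ : ContMDiff (I.tangent.prod I.tangent) (I.prod I).tangent ∞ F₂ :=
    contMDiff_equivTangentBundleProd_symm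
  let F₃ : TangentBundle (I.prod I) (G × G) → TangentBundle I G :=
    tangentMap (I.prod I) I (fun (p : G × G) ↦ p.1 * p.2)
  have S₃ : ContMDiff (I.prod I).tangent I.tangent ∞ F₃ :=
    ContMDiff.contMDiff_tangentMap (n := ∞) (contMDiff_mul I ∞) (by simp)
  have S := (S₃.comp S₂).comp S₁
  unfold VField.IsSmooth
  convert! S with g
  · simp [F₁, F₂, F₃, fg, fv]
  · simp only [Function.comp_apply, tangentMap, F₃, F₂, F₁, fg, fv]
    rw [mfderiv_prod_eq_add_apply ((contMDiff_mul I ∞).mdifferentiableAt (by simp))]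
    simp +instances only [mulInvariantVectorField]
    exact ((congrArg (· + _) (map_zero _)).trans (zero_add _)).symm

/-- The curvature tensor `R(u,v)w` at the point `x`; being tensorial, it is computed by extending
the three tangent vectors to left-invariant vector fields. -/
def curvatureTensor (D : CovariantDerivative I E (TangentSpace I : G → Type _)) (x : G)
    (u v w : TangentSpace I x) : TangentSpace I x :=
  curvatureField D (leftExtend x u) (leftExtend x v) (leftExtend x w) x

/-- The Ricci tensor at the point `x`: `ρ(u,v)` is the trace of `w ↦ R(w,u)v`. -/
def ricciTensor [FiniteDimensional ℝ E]
    (D : CovariantDerivative I E (TangentSpace I : G → Type _)) (x : G)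
    (u v : TangentSpace I x) : ℝ :=
  letI b : Module.Basis (Fin (Module.finrank ℝ E)) ℝ (TangentSpace I x) := Module.finBasis ℝ E
  ∑ i, b.repr (curvatureTensor D x (b i) u v) i

/-- The tensors `g`, `J`, `Ω` are invariant under all left translations of the group. -/
structure AlmostKahlerStructure.IsLeftInvariant
    (S : AlmostKahlerStructure I G) : Prop where
  g_inv : ∀ (a x : G) (u v : TangentSpace I x),
    S.g.inner (a * x) (mfderiv I I (fun y : G ↦ a * y) x u) (mfderiv I I (fun y : G ↦ a * y) x v)
      = S.g.inner x u v
  J_inv : ∀ (a x : G) (u : TangentSpace I x),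
    S.J (a * x) (mfderiv I I (fun y : G ↦ a * y) x u)
      = mfderiv I I (fun y : G ↦ a * y) x (S.J x u)
  Ω_inv : ∀ (a x : G) (u v : TangentSpace I x),
    S.Ω (a * x) (mfderiv I I (fun y : G ↦ a * y) x u) (mfderiv I I (fun y : G ↦ a * y) x v)
      = S.Ω x u v

end Group

section Vergne

/-- The underlying vector space of the Lie algebra `𝔤_{4,9}(α)`. Its basis `f₁, f₂, f₃, f₄` is the
standard one, with coordinates indexed by `0, 1, 2, 3`. -/
def VergneG49 (_α : ℝ) : Type := Fin 4 → ℝ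

namespace VergneG49

variable {α : ℝ}

instance : AddCommGroup (VergneG49 α) := inferInstanceAs (AddCommGroup (Fin 4 → ℝ))

instance : Module ℝ (VergneG49 α) := inferInstanceAs (Module ℝ (Fin 4 → ℝ))

/-- The dual basis `f^1, f^2, f^3, f^4` of 1-forms, indexed by `0, 1, 2, 3`. -/
def f (i : Fin 4) : VergneG49 α →ₗ[ℝ] ℝ := (LinearMap.proj i : (Fin 4 → ℝ) →ₗ[ℝ] ℝ)

theorem ext_f {x y : VergneG49 α} (h : ∀ i, f i x = f i y) : x = y := funext h

/-- The bracket with `[f₁,f₂] = (α-1) f₂`, `[f₁,f₃] = f₃`, `[f₁,f₄] = α f₄`, `[f₂,f₃] = f₄`. -/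
instance : Bracket (VergneG49 α) (VergneG49 α) where
  bracket x y := (![0,
    (α - 1) * (f 0 x * f 1 y - f 0 y * f 1 x),
    f 0 x * f 2 y - f 0 y * f 2 x,
    α * (f 0 x * f 3 y - f 0 y * f 3 x) + (f 1 x * f 2 y - f 1 y * f 2 x)] : Fin 4 → ℝ)

theorem f_zero_lie (x y : VergneG49 α) : f 0 ⁅x, y⁆ = 0 := rfl

theorem f_one_lie (x y : VergneG49 α) :
    f 1 ⁅x, y⁆ = (α - 1) * (f 0 x * f 1 y - f 0 y * f 1 x) := rfl

theorem f_two_lie (x y : VergneG49 α) :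
    f 2 ⁅x, y⁆ = f 0 x * f 2 y - f 0 y * f 2 x := rfl

theorem f_three_lie (x y : VergneG49 α) :
    f 3 ⁅x, y⁆ = α * (f 0 x * f 3 y - f 0 y * f 3 x) + (f 1 x * f 2 y - f 1 y * f 2 x) := rfl

instance : LieRing (VergneG49 α) where
  add_lie x y z := ext_f fun i ↦ by
    fin_cases i <;>
      simp [f_zero_lie, f_one_lie, f_two_lie, f_three_lie] <;> ring
  lie_add x y z := ext_f fun i ↦ by
    fin_cases i <;>
      simp [f_zero_lie, f_one_lie, f_two_lie, f_three_lie] <;> ring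
  lie_self x := ext_f fun i ↦ by
    fin_cases i <;>
      simp [f_zero_lie, f_one_lie, f_two_lie, f_three_lie]
  leibniz_lie x y z := ext_f fun i ↦ by
    fin_cases i <;>
      simp [f_zero_lie, f_one_lie, f_two_lie, f_three_lie] <;> ring

instance : LieAlgebra ℝ (VergneG49 α) where
  lie_smul c x y := ext_f fun i ↦ by
    fin_cases i <;>
      simp [f_zero_lie, f_one_lie, f_two_lie, f_three_lie] <;> ring

/-- The metric `h = (f^1)² + (f^2)² + (f^3)² + (f^4)²`, for which `f₁, …, f₄` is orthonormal. -/
def h (x y : VergneG49 α) : ℝ := ∑ i, f i x * f i y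

end VergneG49

/-- The differential of a 1-form on a Lie algebra: `dβ(X,Y) = -β([X,Y])`. -/
def lieDiff {L : Type*} [LieRing L] [LieAlgebra ℝ L] (β : L →ₗ[ℝ] ℝ) (X Y : L) : ℝ := -β ⁅X, Y⁆

/-- The wedge product of two 1-forms. -/
def wedgeForm {L : Type*} [AddCommGroup L] [Module ℝ L] (β γ : L →ₗ[ℝ] ℝ) (X Y : L) : ℝ :=
  β X * γ Y - β Y * γ X

/-- The structure equations of `𝔤_{4,9}(α)`: `df^1 = 0`, `df^2 = (1-α) f^1∧f^2`,
`df^3 = -f^1∧f^3`, `df^4 = -α f^1∧f^4 - f^2∧f^3`. -/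
theorem VergneG49.structure_equations (α : ℝ) (X Y : VergneG49 α) :
    lieDiff (f 0) X Y = 0 ∧
    lieDiff (f 1) X Y = (1 - α) * wedgeForm (f 0) (f 1) X Y ∧
    lieDiff (f 2) X Y = -wedgeForm (f 0) (f 2) X Y ∧
    lieDiff (f 3) X Y = -α * wedgeForm (f 0) (f 3) X Y - wedgeForm (f 1) (f 2) X Y := by
  simp only [lieDiff, wedgeForm, f_zero_lie, f_one_lie, f_two_lie, f_three_lie]
  refine ⟨by simp, by ring, trivial, by ring⟩

end Vergne

end

/-! Everything left-invariant is determined at the identity. Koszul's formula makes the Levi-Civita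
connection left-invariant, and since the Nijenhuis tensor N is tensorial, strictness gives N ≠ 0 on
the Lie algebra. What remains is algebra on a 4-dimensional Lie algebra
(`exists_lieEquiv_vergneG49`).

N is conjugate-linear in each argument and skew, so in a unitary frame e₀, e₁ = Je₀, e₂, e₃ = Je₂ it
is determined by N(e₀,e₂), and its image is one complex line. Taking e₀ in this line and turning e₂
gives N(e₀,e₂) = 4t e₀ with t > 0 (`exists_adapted_frame`). Closedness of Ω and this value of N fix
the non-unitary part of the connection, leaving 16 real unknowns in the unitary part
(`eq_unitaryConnection`).

Modulo the Jacobi identity, J-invariance of the Ricci tensor is linear in the unknowns, because t ≠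
0 cancels (`unitaryConnection_linear`). Five complex unknowns x, y, q, U, V survive. The Jacobi
identity then yields sums of squares that force all of them to vanish except y, with |y| = t/2
(`eq_zero_of_frameJacobi`). The residual freedom of phase in the frame makes y positive
(`exists_normal_frame`). The brackets then depend on scale alone, and rescaling gives the model
algebra with its metric up to homothety. -/

noncomputable section

/-! ### Tensoriality of the Nijenhuis tensor. -/

section Nijenhuis

variable {E : Type*} [NormedAddCommGroup E] [NormedSpace ℝ E]
  {H : Type*} [TopologicalSpace H] {I : ModelWithCorners ℝ E H}
  {M : Type*} [TopologicalSpace M] [ChartedSpace H M]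

theorem VField.deriv_const (X : VField I M) (c : ℝ) (x : M) :
    X.deriv (fun _ ↦ c) x = 0 := by
  simp [VField.deriv, mvfderiv]

theorem nijenhuis_swap (J : (x : M) → TangentSpace I x →L[ℝ] TangentSpace I x)
    (X Y : VField I M) (x : M) : nijenhuis J X Y x = -nijenhuis J Y X x := by
  simp only [nijenhuis]
  rw [mlieBracket_swap_apply (V := fun y ↦ J y (X y)) (W := fun y ↦ J y (Y y)),
    mlieBracket_swap_apply (V := fun y ↦ J y (X y)) (W := Y),
    mlieBracket_swap_apply (V := X) (W := fun y ↦ J y (Y y)),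
    mlieBracket_swap_apply (V := X) (W := Y)]
  simp only [map_neg]
  abel

variable [IsManifold I ∞ M]

theorem AlmostKahlerStructure.mdifferentiableAt_J (S : AlmostKahlerStructure I M)
    {X : VField I M} {x : M} (hX : MDiffAt (T% X) x) :
    MDiffAt (T% (fun y ↦ S.J y (X y))) x := by
  have : IsManifold I 1 M := IsManifold.of_le (n := ∞) ENat.LEInfty.out
  have hJ := (S.J_smooth x).mdifferentiableAt (by simp)
  exact MDifferentiableAt.clm_bundle_apply (F₁ := E) (F₂ := E)
    (E₁ := (TangentSpace I : M → Type _)) (E₂ := (TangentSpace I : M → Type _))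
    (b := fun y : M ↦ y) hJ hX

variable [CompleteSpace E]

/-- Replacing X by fX produces the derivative terms ∓(JY f) JX, which cancel in pairs, and (Y f)(J²X
+ X), which vanishes because J² = -1. -/
theorem AlmostKahlerStructure.tensorialAt_nijenhuis_left (S : AlmostKahlerStructure I M)
    (Y : VField I M) (x : M) :
    TensorialAt I E (fun X : VField I M ↦ nijenhuis S.J X Y x) x where
  smul {f X} hf hX := by
    have : IsManifold I 2 M := IsManifold.of_le (n := ∞) ENat.LEInfty.out
    have hJX := S.mdifferentiableAt_J hX
    have e : (fun y ↦ S.J y ((f • X) y)) = f • (fun y ↦ S.J y (X y)) := by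
      ext1 y
      simp
    simp only [nijenhuis]
    rw [e, mlieBracket_smul_left hf hJX, mlieBracket_smul_left hf hJX,
      mlieBracket_smul_left hf hX, mlieBracket_smul_left hf hX]
    simp only [map_add, map_smul, map_neg, S.J_sq, neg_smul]
    module
  add {X X'} hX hX' := by
    have : IsManifold I 2 M := IsManifold.of_le (n := ∞) ENat.LEInfty.out
    have hJX := S.mdifferentiableAt_J hX
    have hJX' := S.mdifferentiableAt_J hX'
    have e : (fun y ↦ S.J y ((X + X') y)) = (fun y ↦ S.J y (X y)) + (fun y ↦ S.J y (X' y)) := by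
      ext1 y
      simp
    simp only [nijenhuis]
    rw [e, mlieBracket_add_left hJX hJX', mlieBracket_add_left hJX hJX',
      mlieBracket_add_left hX hX', mlieBracket_add_left hX hX']
    simp only [map_add]
    abel

theorem AlmostKahlerStructure.tensorialAt_nijenhuis_right (S : AlmostKahlerStructure I M)
    (X : VField I M) (x : M) :
    TensorialAt I E (fun Y : VField I M ↦ nijenhuis S.J X Y x) x := by
  have h := S.tensorialAt_nijenhuis_left X x
  constructor
  · intro f Y hf hY
    have := h.smul hf hY
    rw [nijenhuis_swap, this, nijenhuis_swap S.J X Y, smul_neg]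
  · intro Y Y' hY hY'
    have := h.add hY hY'
    rw [nijenhuis_swap, this, nijenhuis_swap S.J X Y, nijenhuis_swap S.J X Y', neg_add]

variable [FiniteDimensional ℝ E]

/-- The Nijenhuis tensor at a point depends only on the values of the vector fields there. -/
theorem AlmostKahlerStructure.nijenhuis_congr (S : AlmostKahlerStructure I M)
    {X X' Y Y' : VField I M} {x : M} (hX : MDiffAt (T% X) x) (hX' : MDiffAt (T% X') x)
    (hY : MDiffAt (T% Y) x) (hY' : MDiffAt (T% Y') x) (hXX' : X x = X' x) (hYY' : Y x = Y' x) :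
    nijenhuis S.J X Y x = nijenhuis S.J X' Y' x := by
  have : IsManifold I 2 M := IsManifold.of_le (n := ∞) ENat.LEInfty.out
  have : ContMDiffVectorBundle 1 E (TangentSpace I : M → Type _) I := inferInstance
  exact TensorialAt.pointwise₂ (Φ := fun X Y : VField I M ↦ nijenhuis S.J X Y x)
    (fun _ _ ↦ S.tensorialAt_nijenhuis_left _ x) (fun _ _ ↦ S.tensorialAt_nijenhuis_right _ x)
    hX hX' hY hY' hXX' hYY'

end Nijenhuis

/-! ### Left-invariant tensors and connections, reduced to the Lie algebra. -/

section LeftInvariant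

variable {E : Type*} [NormedAddCommGroup E] [NormedSpace ℝ E]
  {H : Type*} [TopologicalSpace H] {I : ModelWithCorners ℝ E H}
  {G : Type*} [TopologicalSpace G] [ChartedSpace H G] [Group G]

theorem mulInvariantVectorField_one (u : GroupLieAlgebra I G) :
    mulInvariantVectorField u 1 = u := by
  have h : (fun y : G ↦ (1 : G) * y) = id := by ext y; simp
  unfold mulInvariantVectorField
  rw [h, mfderiv_id]
  rfl

theorem leftExtend_one (u : GroupLieAlgebra I G) :
    leftExtend (1 : G) u = mulInvariantVectorField u := by
  have h : (fun y : G ↦ (1 : G)⁻¹ * y) = id := by ext y; simp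
  unfold leftExtend
  rw [h, mfderiv_id]
  rfl

variable [LieGroup I ∞ G]

theorem exists_mulInvariantVectorField_eq (x : G) (u : TangentSpace I x) :
    ∃ v : GroupLieAlgebra I G, mulInvariantVectorField v x = u :=
  ⟨_, leftExtend_apply_self x u⟩

variable {S : AlmostKahlerStructure I G}

theorem AlmostKahlerStructure.IsLeftInvariant.inner_mulInvariantVectorField
    (hS : S.IsLeftInvariant) (x : G) (u v : GroupLieAlgebra I G) :
    S.g.inner x (mulInvariantVectorField u x) (mulInvariantVectorField v x)
      = S.g.inner 1 u v := by
  -- The points `x * 1` and `x` are equal but not definitionally so. Every tangent space is the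
  -- model `E`, so the vectors are kept in `E` and only the base point is substituted.
  have key : ∀ y : G, y = x → ∀ a b : E, S.g.inner y a b = S.g.inner x a b := by
    rintro y rfl a b
    rfl
  exact (key (x * 1) (mul_one x) _ _).symm.trans (hS.g_inv x 1 u v)

theorem AlmostKahlerStructure.IsLeftInvariant.J_mulInvariantVectorField
    (hS : S.IsLeftInvariant) (u : GroupLieAlgebra I G) :
    (fun x ↦ S.J x (mulInvariantVectorField u x))
      = (mulInvariantVectorField (S.J 1 u : GroupLieAlgebra I G) : VField I G) := by
  ext1 x
  have key : ∀ y : G, y = x → ∀ a : E, (S.J y a : E) = S.J x a := by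
    rintro y rfl a
    rfl
  exact (key (x * 1) (mul_one x) _).symm.trans (hS.J_inv x 1 u)

theorem AlmostKahlerStructure.IsLeftInvariant.Ω_mulInvariantVectorField
    (hS : S.IsLeftInvariant) (x : G) (u v : GroupLieAlgebra I G) :
    S.Ω x (mulInvariantVectorField u x) (mulInvariantVectorField v x)
      = S.g.inner 1 (S.J 1 u) v := by
  rw [S.compat, ← hS.inner_mulInvariantVectorField x]
  exact congrArg (fun w ↦ S.g.inner x w _) (congrFun (hS.J_mulInvariantVectorField u) x)

variable [CompleteSpace E]

theorem mlieBracket_mulInvariantVectorField (u v : GroupLieAlgebra I G) :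
    mlieBracket I (mulInvariantVectorField u) (mulInvariantVectorField v)
      = mulInvariantVectorField ⁅u, v⁆ :=
  (mulInvariantVector_mlieBracket u v).symm

/-- A left-invariant closed form `Ω` satisfies the cocycle condition on the Lie algebra. -/
theorem AlmostKahlerStructure.IsLeftInvariant.closed_lie (hS : S.IsLeftInvariant)
    (u v w : GroupLieAlgebra I G) :
    S.g.inner 1 (S.J 1 ⁅u, v⁆) w + S.g.inner 1 (S.J 1 ⁅v, w⁆) u + S.g.inner 1 (S.J 1 ⁅w, u⁆) v
      = 0 := by
  have h := S.closed _ _ _ (mulInvariantVectorField_isSmooth u)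
    (mulInvariantVectorField_isSmooth v) (mulInvariantVectorField_isSmooth w) 1
  simp only [extDerivTwoForm, mlieBracket_mulInvariantVectorField, hS.Ω_mulInvariantVectorField,
    VField.deriv_const] at h
  linarith

theorem AlmostKahlerStructure.IsLeftInvariant.nijenhuis_mulInvariantVectorField
    (hS : S.IsLeftInvariant) (u v : GroupLieAlgebra I G) (x : G) :
    nijenhuis S.J (mulInvariantVectorField u) (mulInvariantVectorField v) x
      = mulInvariantVectorField (⁅(S.J 1 u : GroupLieAlgebra I G), (S.J 1 v : GroupLieAlgebra I G)⁆
        - S.J 1 ⁅(S.J 1 u : GroupLieAlgebra I G), v⁆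
        - S.J 1 ⁅u, (S.J 1 v : GroupLieAlgebra I G)⁆ - ⁅u, v⁆ : GroupLieAlgebra I G) x := by
  have hsub : ∀ a b : GroupLieAlgebra I G, mulInvariantVectorField (a - b) x
      = mulInvariantVectorField a x - mulInvariantVectorField b x := fun a b ↦ map_sub _ _ _
  have hJ : ∀ a, S.J x (mulInvariantVectorField a x) = _ :=
    fun a ↦ congrFun (hS.J_mulInvariantVectorField a) x
  simp only [nijenhuis, hS.J_mulInvariantVectorField, mlieBracket_mulInvariantVectorField, hJ, hsub]

theorem AlmostKahlerStructure.IsLeftInvariant.exists_nijenhuis_ne_zero [FiniteDimensional ℝ E]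
    (hS : S.IsLeftInvariant) (hstrict : S.IsStrict) :
    ∃ u v : GroupLieAlgebra I G,
      ⁅(S.J 1 u : GroupLieAlgebra I G), (S.J 1 v : GroupLieAlgebra I G)⁆
        - S.J 1 ⁅(S.J 1 u : GroupLieAlgebra I G), v⁆
        - S.J 1 ⁅u, (S.J 1 v : GroupLieAlgebra I G)⁆ - ⁅u, v⁆ ≠ 0 := by
  by_contra! h
  refine hstrict fun X Y hX hY x ↦ ?_
  obtain ⟨u, hu⟩ := exists_mulInvariantVectorField_eq x (X x)
  obtain ⟨v, hv⟩ := exists_mulInvariantVectorField_eq x (Y x)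
  have hd {Z : VField I G} (hZ : Z.IsSmooth) : MDiffAt (T% Z) x :=
    (hZ x).mdifferentiableAt (by simp)
  rw [S.nijenhuis_congr (hd hX) (hd (mulInvariantVectorField_isSmooth u)) (hd hY)
    (hd (mulInvariantVectorField_isSmooth v)) hu.symm hv.symm,
    hS.nijenhuis_mulInvariantVectorField, h u v]
  exact map_zero _

/-! ### The Levi-Civita connection of a left-invariant metric -/

/-- The connection `∇_u v` on the Lie algebra induced by a connection on the group. -/
def lieConnection (D : CovariantDerivative I E (TangentSpace I : G → Type _))
    (u v : GroupLieAlgebra I G) : GroupLieAlgebra I G :=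
  D (mulInvariantVectorField v) 1 u

variable [FiniteDimensional ℝ E] {D : CovariantDerivative I E (TangentSpace I : G → Type _)}

theorem AlmostKahlerStructure.IsLeftInvariant.leviCivita_skew (hS : S.IsLeftInvariant)
    (hD : IsLeviCivita S.g D) (x : G)
    (u v w : GroupLieAlgebra I G) :
    S.g.inner x (D (mulInvariantVectorField v) x (mulInvariantVectorField u x))
        (mulInvariantVectorField w x)
      + S.g.inner x (D (mulInvariantVectorField w) x (mulInvariantVectorField u x))
        (mulInvariantVectorField v x) = 0 := by
  have h := hD.metric _ _ _ (mulInvariantVectorField_isSmooth u)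
    (mulInvariantVectorField_isSmooth v) (mulInvariantVectorField_isSmooth w) x
  simp only [hS.inner_mulInvariantVectorField, VField.deriv_const] at h
  rw [S.g.symm x (D (mulInvariantVectorField w) x (mulInvariantVectorField u x)), ← h]

theorem IsLeviCivita.sub_mulInvariantVectorField (hD : IsLeviCivita S.g D) (x : G)
    (u v : GroupLieAlgebra I G) :
    D (mulInvariantVectorField v) x (mulInvariantVectorField u x)
        - D (mulInvariantVectorField u) x (mulInvariantVectorField v x)
      = mulInvariantVectorField ⁅u, v⁆ x := by
  have hd (z : GroupLieAlgebra I G) :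
      MDiffAt (T% (mulInvariantVectorField z : VField I G)) x :=
    (mulInvariantVectorField_isSmooth z x).mdifferentiableAt (by simp)
  have : IsManifold I 2 G := IsManifold.of_le (n := ∞) ENat.LEInfty.out
  rw [(D.torsion_eq_zero_iff.1 hD.torsion_free) (hd u) (hd v), mlieBracket_mulInvariantVectorField]

/-- Koszul's formula: its three derivative terms are absent because left-invariant fields have
constant inner products. The right side does not involve `x`, which is why the connection is
left-invariant. -/
theorem AlmostKahlerStructure.IsLeftInvariant.two_mul_inner_leviCivita (hS : S.IsLeftInvariant)
    (hD : IsLeviCivita S.g D) (x : G) (u v w : GroupLieAlgebra I G) :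
    2 * S.g.inner x (D (mulInvariantVectorField v) x (mulInvariantVectorField u x))
        (mulInvariantVectorField w x)
      = S.g.inner 1 ⁅u, v⁆ w - S.g.inner 1 ⁅v, w⁆ u + S.g.inner 1 ⁅w, u⁆ v := by
  have t (a b c : GroupLieAlgebra I G) := congrArg (fun z ↦ S.g.inner x z
    (mulInvariantVectorField c x)) (hD.sub_mulInvariantVectorField x a b)
  simp only [map_sub, sub_apply, hS.inner_mulInvariantVectorField] at t
  have s := hS.leviCivita_skew hD x
  linarith [t u v w, t v w u, t w u v, s u v w, s v w u, s w u v]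

/-- The Levi-Civita connection of a left-invariant metric is left-invariant. -/
theorem AlmostKahlerStructure.IsLeftInvariant.leviCivita_mulInvariantVectorField
    (hS : S.IsLeftInvariant) (hD : IsLeviCivita S.g D) (u v : GroupLieAlgebra I G) :
    (fun x ↦ D (mulInvariantVectorField v) x (mulInvariantVectorField u x))
      = (mulInvariantVectorField (lieConnection D u v) : VField I G) := by
  ext1 x
  have key (w : GroupLieAlgebra I G) :
      S.g.inner x (D (mulInvariantVectorField v) x (mulInvariantVectorField u x)
        - mulInvariantVectorField (lieConnection D u v) x) (mulInvariantVectorField w x) = 0 := by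
    have h1 := hS.two_mul_inner_leviCivita hD 1 u v w
    simp only [mulInvariantVectorField_one] at h1
    rw [map_sub, sub_apply, hS.inner_mulInvariantVectorField]
    unfold lieConnection
    linarith [hS.two_mul_inner_leviCivita hD x u v w]
  obtain ⟨w, hw⟩ := exists_mulInvariantVectorField_eq x
    (D (mulInvariantVectorField v) x (mulInvariantVectorField u x)
        - mulInvariantVectorField (lieConnection D u v) x)
  have := key w
  rw [hw] at this
  by_contra hne
  exact (S.g.pos x _ (sub_ne_zero.2 hne)).ne' this

theorem AlmostKahlerStructure.IsLeftInvariant.curvatureTensor_one (hS : S.IsLeftInvariant)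
    (hD : IsLeviCivita S.g D) (u v w : GroupLieAlgebra I G) :
    curvatureTensor D 1 u v w = lieConnection D u (lieConnection D v w)
      - lieConnection D v (lieConnection D u w) - lieConnection D ⁅u, v⁆ w := by
  simp only [curvatureTensor, curvatureField, leftExtend_one,
    hS.leviCivita_mulInvariantVectorField hD, mulInvariantVectorField_one,
    mlieBracket_mulInvariantVectorField]
  rfl

end LeftInvariant

/-! ### Jacobi and Ricci equations in a unitary frame. -/

section FrameAlgebra

/-- The component on `e_l` of the cyclic sum of `⁅⁅e_i, e_j⁆, e_k⁆`, when the torsion-free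
connection has coefficients `Γ` in the frame `e`. -/
def frameJacobi (Γ : Fin 4 → Fin 4 → Fin 4 → ℝ) (i j k l : Fin 4) : ℝ :=
  ∑ m, ((Γ i j m - Γ j i m) * (Γ m k l - Γ k m l) + (Γ j k m - Γ k j m) * (Γ m i l - Γ i m l)
    + (Γ k i m - Γ i k m) * (Γ m j l - Γ j m l))

/-- The Ricci tensor in a frame in which the torsion-free connection has coefficients `Γ`. -/
def frameRicci (Γ : Fin 4 → Fin 4 → Fin 4 → ℝ) (j k : Fin 4) : ℝ :=
  ∑ i, ∑ m, (Γ j k m * Γ i m i - Γ i k m * Γ j m i - (Γ i j m - Γ j i m) * Γ m k i)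

/-- The coefficients `g(∇_{e_i} e_j, e_k)` of an almost Kähler Levi-Civita connection in an adapted
unitary frame. With `θ¹ = e¹ + i e²` and `θ² = e³ + i e⁴`, the unitary part of the connection has
diagonal entries `i a`, `i b` and off-diagonal entry `s + i r`, and the
remaining part, which measures the failure of integrability, is `-t θ̄¹`. -/
def unitaryConnection (a b s r : Fin 4 → ℝ) (t : ℝ) (i j k : Fin 4) : ℝ :=
  (!![0, a i, -(s i + ![-t, 0, 0, 0] i), r i - ![0, t, 0, 0] i;
     -a i, 0, -(r i + ![0, t, 0, 0] i), -(s i - ![-t, 0, 0, 0] i);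
     s i + ![-t, 0, 0, 0] i, r i + ![0, t, 0, 0] i, 0, b i;
     -(r i - ![0, t, 0, 0] i), s i - ![-t, 0, 0, 0] i, -b i, 0] : Matrix (Fin 4) (Fin 4) ℝ) j k

/-- In each J-invariance condition the terms quadratic in `a`, `b`, `s`, `r` cancel against
components of the Jacobi identity. What is left is `t` times a linear form, and `t` can be divided
out. -/
theorem unitaryConnection_linear {a b s r : Fin 4 → ℝ} {t : ℝ} (ht : 0 < t)
    (hjac : ∀ i j k l, frameJacobi (unitaryConnection a b s r t) i j k l = 0)
    (h00 : frameRicci (unitaryConnection a b s r t) 1 1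
      = frameRicci (unitaryConnection a b s r t) 0 0)
    (h01 : -frameRicci (unitaryConnection a b s r t) 1 0
      = frameRicci (unitaryConnection a b s r t) 0 1)
    (h22 : frameRicci (unitaryConnection a b s r t) 3 3
      = frameRicci (unitaryConnection a b s r t) 2 2)
    (h23 : -frameRicci (unitaryConnection a b s r t) 3 2
      = frameRicci (unitaryConnection a b s r t) 2 3)
    (h20 : frameRicci (unitaryConnection a b s r t) 3 1
      = frameRicci (unitaryConnection a b s r t) 2 0)
    (h30 : -frameRicci (unitaryConnection a b s r t) 2 1
      = frameRicci (unitaryConnection a b s r t) 3 0) :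
    r 1 = s 0 ∧ s 1 = -r 0 ∧ b 2 = -2 * a 2 ∧ b 3 = -2 * a 3 ∧
      s 2 - r 3 + (2 * a 1 + b 1) = 0 ∧ r 2 + s 3 - (2 * a 0 + b 0) = 0 := by
  have cancel {z : ℝ} (h : t * z = 0) : z = 0 := (mul_eq_zero.1 h).resolve_left ht.ne'
  have j012_0 := hjac 0 1 2 0
  have j012_1 := hjac 0 1 2 1
  have j012_2 := hjac 0 1 2 2
  have j012_3 := hjac 0 1 2 3
  have j013_0 := hjac 0 1 3 0
  have j013_1 := hjac 0 1 3 1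
  have j013_2 := hjac 0 1 3 2
  have j013_3 := hjac 0 1 3 3
  have j023_0 := hjac 0 2 3 0
  have j023_1 := hjac 0 2 3 1
  have j123_0 := hjac 1 2 3 0
  simp [frameJacobi, unitaryConnection, Fin.sum_univ_four] at j012_0 j012_1 j012_2 j012_3 j013_0
  simp [frameJacobi, unitaryConnection, Fin.sum_univ_four] at j013_1 j013_2 j013_3 j023_0 j023_1 j123_0
  simp [frameRicci, unitaryConnection, Fin.sum_univ_four] at h00 h01 h22 h23 h20 h30
  refine ⟨?_, ?_, ?_, ?_, ?_, ?_⟩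
  · linear_combination -cancel (z := s 0 - r 1) (by
      linear_combination (-1/4)*h22 + (1/4)*j012_3 + (1/4)*j013_2)
  · linear_combination cancel (z := r 0 + s 1) (by
      linear_combination (1/4)*h23 + (1/4)*j012_2 + (-1/4)*j013_3)
  · linear_combination cancel (z := 2 * a 2 + b 2) (by
      linear_combination (-1/4)*h01 + (-1/4)*j012_2 + (-1/4)*j013_3 + (-1/2)*j023_0)
  · linear_combination cancel (z := 2 * a 3 + b 3) (by
      linear_combination (-1/4)*h00 + (1/4)*j023_1 + (1/4)*j123_0)
  · refine cancel ?_
    linear_combination (1/2)*h20 + (-1/2)*j012_1 + (-1/2)*j013_0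
  · refine cancel ?_
    linear_combination (-1/2)*h30 + (-1/2)*j012_0 + (1/2)*j013_1

/-- In complex notation, the unknowns are `x`, `y`, `q`, `U`, `V`, given by real and imaginary
parts, and `w = x - q`. -/
theorem eq_zero_of_frameJacobi {x₁ x₂ y₁ y₂ q₁ q₂ U₁ U₂ V₁ V₂ t : ℝ} (ht : 0 < t)
    (hjac : ∀ i j k l, frameJacobi (unitaryConnection ![2 * x₂, -2 * x₁, 2 * y₂, -2 * y₁]
      ![2 * q₂ - 4 * x₂, -2 * q₁ + 4 * x₁, -4 * y₂, 4 * y₁] ![U₁, U₂, V₁ + q₁, V₂ + q₂]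
      ![-U₂, U₁, -V₂ + q₂, V₁ - q₁] t) i j k l = 0) :
    (x₁ = 0 ∧ x₂ = 0) ∧ (q₁ = 0 ∧ q₂ = 0) ∧ (U₁ = 0 ∧ U₂ = 0) ∧ (V₁ = 0 ∧ V₂ = 0) ∧
      4 * (y₁ ^ 2 + y₂ ^ 2) = t ^ 2 := by
  have j012_0 := hjac 0 1 2 0
  have j012_1 := hjac 0 1 2 1
  have j012_2 := hjac 0 1 2 2
  have j012_3 := hjac 0 1 2 3
  have j013_0 := hjac 0 1 3 0
  have j013_1 := hjac 0 1 3 1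
  have j013_2 := hjac 0 1 3 2
  have j013_3 := hjac 0 1 3 3
  have j023_0 := hjac 0 2 3 0
  have j023_1 := hjac 0 2 3 1
  have j023_2 := hjac 0 2 3 2
  have j023_3 := hjac 0 2 3 3
  have j123_0 := hjac 1 2 3 0
  have j123_2 := hjac 1 2 3 2
  have j123_3 := hjac 1 2 3 3
  simp [frameJacobi, unitaryConnection, Fin.sum_univ_four] at j012_0 j012_1 j012_2 j012_3 j013_0
  simp [frameJacobi, unitaryConnection, Fin.sum_univ_four] at j013_1 j013_2 j013_3 j023_0 j023_1 j023_2 j023_3 j123_0 j123_2 j123_3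
  -- With w = x - q, `E4₁` and `E4₂` say tU = -conj(qw), while `E8₁` and `E8₂` say qy = 2t conj(q).
  -- `E2` and `E5` are real equations in squared moduli and real inner products.
  have E2 : (x₁ - q₁) * q₁ + (x₂ - q₂) * q₂ - 4 * (y₁ ^ 2 + y₂ ^ 2) - 2 * (y₁ * U₁ + y₂ * U₂)
      + t ^ 2 = 0 := by
    linear_combination (-1/4)*j023_1 + (1/4)*j123_0
  have E4₁ : t * U₁ = -(q₁ * (x₁ - q₁) - q₂ * (x₂ - q₂)) := by
    linear_combination (-1/4)*j023_1 + (-1/4)*j123_0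
  have E4₂ : t * U₂ = q₁ * (x₂ - q₂) + q₂ * (x₁ - q₁) := by
    linear_combination -((1/4)*j012_2 + (1/4)*j013_3 + (1/2)*j023_0)
  have E5 : 4 * (x₁ ^ 2 + x₂ ^ 2) - (x₁ * q₁ + x₂ * q₂) + (U₁ ^ 2 + U₂ ^ 2) + (V₁ ^ 2 + V₂ ^ 2)
      - 2 * (y₁ * U₁ + y₂ * U₂) = 0 := by
    linear_combination (1/4)*j012_3 + (-1/4)*j013_2
  have E8₁ : q₁ * y₁ - q₂ * y₂ = 2 * t * q₁ := by
    linear_combination (-1/2)*j012_1 + (-1/2)*j013_0 + (1/4)*j023_3 + (1/4)*j123_2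
  have E8₂ : q₁ * y₂ + q₂ * y₁ = -2 * t * q₂ := by
    linear_combination (1/2)*j012_0 + (-1/2)*j013_1 + (-1/4)*j023_2 + (1/4)*j123_3
  clear hjac j012_0 j012_1 j012_2 j012_3 j013_0 j013_1 j013_2 j013_3 j023_0 j023_1 j023_2 j023_3
  clear j123_0 j123_2 j123_3
  -- Multiply y by conj(tU) = -qw and replace qy by 2t conj(q).
  have hyU : y₁ * U₁ + y₂ * U₂ = -2 * ((x₁ - q₁) * q₁ + (x₂ - q₂) * q₂) := by
    have : t * (y₁ * U₁ + y₂ * U₂ + 2 * ((x₁ - q₁) * q₁ + (x₂ - q₂) * q₂)) = 0 := by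
      linear_combination y₁ * E4₁ + y₂ * E4₂ - (x₁ - q₁) * E8₁ + (x₂ - q₂) * E8₂
    linarith [(mul_eq_zero.1 this).resolve_left ht.ne']
  have hq : q₁ ^ 2 + q₂ ^ 2 = 0 := by
    by_contra hne
    -- For q ≠ 0, taking moduli in qy = 2t conj(q) gives |y| = 2t; then `E2` and `hyU` give Re(w
    -- conj(q)) = 3t².
    have hy : y₁ ^ 2 + y₂ ^ 2 = 4 * t ^ 2 := by
      have : (q₁ ^ 2 + q₂ ^ 2) * (y₁ ^ 2 + y₂ ^ 2 - 4 * t ^ 2) = 0 := by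
        linear_combination (q₁ * y₁ - q₂ * y₂ + 2 * t * q₁) * E8₁
          + (q₁ * y₂ + q₂ * y₁ - 2 * t * q₂) * E8₂
      linarith [(mul_eq_zero.1 this).resolve_left hne]
    have hwq : (x₁ - q₁) * q₁ + (x₂ - q₂) * q₂ = 3 * t ^ 2 := by linarith
    have hpos : 0 < q₁ ^ 2 + q₂ ^ 2 := lt_of_le_of_ne (by positivity) (Ne.symm hne)
    -- Substituting x = w + q, `E5` becomes 4|w|² + 3|q|² + |U|² + |V|² + 33t² = 0, which is
    -- impossible.
    nlinarith [sq_nonneg (x₁ - q₁), sq_nonneg (x₂ - q₂), sq_nonneg U₁, sq_nonneg U₂,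
      sq_nonneg V₁, sq_nonneg V₂, sq_nonneg t]
  have hq₁ : q₁ = 0 := by nlinarith [sq_nonneg q₁, sq_nonneg q₂]
  have hq₂ : q₂ = 0 := by nlinarith [sq_nonneg q₁, sq_nonneg q₂]
  subst hq₁ hq₂
  simp only [mul_zero, zero_mul, add_zero, sub_zero, neg_zero, mul_eq_zero, ht.ne',
    false_or] at E4₁ E4₂ E5 E2
  subst E4₁ E4₂
  have hx₁ : x₁ = 0 := by
    nlinarith [sq_nonneg x₁, sq_nonneg x₂, sq_nonneg V₁, sq_nonneg V₂]
  have hx₂ : x₂ = 0 := by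
    nlinarith [sq_nonneg x₁, sq_nonneg x₂, sq_nonneg V₁, sq_nonneg V₂]
  have hV₁ : V₁ = 0 := by
    nlinarith [sq_nonneg x₁, sq_nonneg x₂, sq_nonneg V₁, sq_nonneg V₂]
  have hV₂ : V₂ = 0 := by
    nlinarith [sq_nonneg x₁, sq_nonneg x₂, sq_nonneg V₁, sq_nonneg V₂]
  exact ⟨⟨hx₁, hx₂⟩, ⟨rfl, rfl⟩, ⟨rfl, rfl⟩, ⟨hV₁, hV₂⟩, by linarith⟩

/-- A unitary connection of an almost Kähler Lie algebra with `J`-invariant Ricci tensor is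
determined, up to the phase of `y`, by its non-integrability `t`. -/
theorem exists_unitaryConnection_eq {a b s r : Fin 4 → ℝ} {t : ℝ} (ht : 0 < t)
    (hjac : ∀ i j k l, frameJacobi (unitaryConnection a b s r t) i j k l = 0)
    (h00 : frameRicci (unitaryConnection a b s r t) 1 1
      = frameRicci (unitaryConnection a b s r t) 0 0)
    (h01 : -frameRicci (unitaryConnection a b s r t) 1 0
      = frameRicci (unitaryConnection a b s r t) 0 1)
    (h22 : frameRicci (unitaryConnection a b s r t) 3 3
      = frameRicci (unitaryConnection a b s r t) 2 2)
    (h23 : -frameRicci (unitaryConnection a b s r t) 3 2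
      = frameRicci (unitaryConnection a b s r t) 2 3)
    (h20 : frameRicci (unitaryConnection a b s r t) 3 1
      = frameRicci (unitaryConnection a b s r t) 2 0)
    (h30 : -frameRicci (unitaryConnection a b s r t) 2 1
      = frameRicci (unitaryConnection a b s r t) 3 0) :
    ∃ y₁ y₂ : ℝ, 4 * (y₁ ^ 2 + y₂ ^ 2) = t ^ 2 ∧ unitaryConnection a b s r t
      = unitaryConnection ![0, 0, 2 * y₂, -2 * y₁] ![0, 0, -4 * y₂, 4 * y₁] 0 0 t := by
  obtain ⟨l1, l2, l3, l4, l5, l6⟩ := unitaryConnection_linear ht hjac h00 h01 h22 h23 h20 h30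
  have vec_ext {v w : Fin 4 → ℝ} (h0 : v 0 = w 0) (h1 : v 1 = w 1) (h2 : v 2 = w 2)
      (h3 : v 3 = w 3) : v = w := by
    ext i
    fin_cases i <;> assumption
  -- The six linear relations leave ten of the sixteen real unknowns free, grouped here into five
  -- complex numbers.
  obtain ⟨x₁, hx₁⟩ : ∃ x, x = -a 1 / 2 := ⟨_, rfl⟩
  obtain ⟨x₂, hx₂⟩ : ∃ x, x = a 0 / 2 := ⟨_, rfl⟩
  obtain ⟨y₁, hy₁⟩ : ∃ x, x = -a 3 / 2 := ⟨_, rfl⟩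
  obtain ⟨y₂, hy₂⟩ : ∃ x, x = a 2 / 2 := ⟨_, rfl⟩
  obtain ⟨q₁, hq₁⟩ : ∃ x, x = -(2 * a 1 + b 1) / 2 := ⟨_, rfl⟩
  obtain ⟨q₂, hq₂⟩ : ∃ x, x = (2 * a 0 + b 0) / 2 := ⟨_, rfl⟩
  obtain ⟨U₁, hU₁⟩ : ∃ x, x = s 0 := ⟨_, rfl⟩
  obtain ⟨U₂, hU₂⟩ : ∃ x, x = -r 0 := ⟨_, rfl⟩
  obtain ⟨V₁, hV₁⟩ : ∃ x, x = s 2 - q₁ := ⟨_, rfl⟩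
  obtain ⟨V₂, hV₂⟩ : ∃ x, x = -r 2 + q₂ := ⟨_, rfl⟩
  have ha : a = ![2 * x₂, -2 * x₁, 2 * y₂, -2 * y₁] := by
    apply vec_ext <;> simp [hx₁, hx₂, hy₁, hy₂] <;> ring
  have hb : b = ![2 * q₂ - 4 * x₂, -2 * q₁ + 4 * x₁, -4 * y₂, 4 * y₁] := by
    apply vec_ext <;> simp [hx₁, hx₂, hy₁, hy₂, hq₁, hq₂] <;> linarith
  have hs : s = ![U₁, U₂, V₁ + q₁, V₂ + q₂] := by
    apply vec_ext <;> simp [hU₁, hU₂, hV₁, hV₂, hq₂] <;> linarith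
  have hr : r = ![-U₂, U₁, -V₂ + q₂, V₁ - q₁] := by
    apply vec_ext <;> simp [hU₁, hU₂, hV₁, hV₂, hq₁] <;> linarith
  clear hx₁ hx₂ hy₁ hy₂ hq₁ hq₂ hU₁ hU₂ hV₁ hV₂ h00 h01 h22 h23 h20 h30 l1 l2 l3 l4 l5 l6 vec_ext
  subst ha hb hs hr
  obtain ⟨⟨z1, z2⟩, ⟨z3, z4⟩, ⟨z5, z6⟩, ⟨z7, z8⟩, hy⟩ := eq_zero_of_frameJacobi ht hjac
  refine ⟨y₁, y₂, hy, ?_⟩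
  subst z1 z2 z3 z4 z5 z6 z7 z8
  have h0 : (![0, 0, 0, 0] : Fin 4 → ℝ) = 0 := by simp
  simp only [mul_zero, sub_zero, neg_zero, add_zero, h0]

/-- The parametrization of the connections of almost Kähler structures in an adapted frame. -/
theorem eq_unitaryConnection {Γ : Fin 4 → Fin 4 → Fin 4 → ℝ} {t : ℝ}
    (hskew : ∀ i j k, Γ i j k = -Γ i k j) {c : Fin 4 → Fin 4 → Fin 4 → ℝ}
    (hc : ∀ i j k, c i j k = Γ i j k - Γ j i k)
    (h012 : c 2 0 0 - c 0 1 3 - c 1 2 1 = 0) (h013 : c 0 1 2 - c 1 3 1 + c 3 0 0 = 0)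
    (h023 : c 0 2 2 - c 2 3 1 - c 3 0 3 = 0) (h123 : c 1 2 2 + c 2 3 0 - c 3 1 3 = 0)
    (hN0 : c 1 3 0 + c 1 2 1 + c 0 3 1 - c 0 2 0 = 4 * t)
    (hN1 : c 1 3 1 - c 1 2 0 - c 0 3 0 - c 0 2 1 = 0)
    (hN2 : c 1 3 2 + c 1 2 3 + c 0 3 3 - c 0 2 2 = 0)
    (hN3 : c 1 3 3 - c 1 2 2 - c 0 3 2 - c 0 2 3 = 0) :
    Γ = unitaryConnection (fun i ↦ Γ i 0 1) (fun i ↦ Γ i 2 3)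
      (fun i ↦ (Γ i 2 0 + Γ i 3 1) / 2) (fun i ↦ (Γ i 2 1 - Γ i 3 0) / 2) t := by
  have hdiag (i j) : Γ i j j = 0 := by linarith [hskew i j j]
  have k01 (i) := hskew i 1 0
  have k02 (i) := hskew i 0 2
  have k03 (i) := hskew i 0 3
  have k12 (i) := hskew i 1 2
  have k13 (i) := hskew i 1 3
  have k23 (i) := hskew i 3 2
  simp only [hc, k01, k02, k03, k12, k13, k23, hdiag] at h012 h013 h023 h123 hN0 hN1 hN2 hN3
  -- The complement of u(2) in so(4) has dimension 2, so the non-unitary part has 8 real components.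
  -- They are determined by the four equations of dΩ = 0 and the four of N(e₀,e₂) = 4t e₀.
  have e (i) : Γ i = unitaryConnection (fun i ↦ Γ i 0 1) (fun i ↦ Γ i 2 3)
      (fun i ↦ (Γ i 2 0 + Γ i 3 1) / 2) (fun i ↦ (Γ i 2 1 - Γ i 3 0) / 2) t i := by
    ext j k
    fin_cases i <;> fin_cases j <;> fin_cases k <;>
      simp [unitaryConnection, hdiag] <;>
      linarith [k01 0, k01 1, k01 2, k01 3, k02 0, k02 1, k02 2, k02 3, k03 0, k03 1, k03 2, k03 3,
        k12 0, k12 1, k12 2, k12 3, k13 0, k13 1, k13 2, k13 3, k23 0, k23 1, k23 2, k23 3]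
  exact funext e

end FrameAlgebra

/-! ### Almost Kähler Lie algebras and unitary frames. -/

/-- An almost Kähler structure on a Lie algebra, together with its Levi-Civita connection. -/
structure AlmostKahlerLieAlgebra (L : Type*) [LieRing L] [LieAlgebra ℝ L] where
  /-- The inner product. -/
  metric : L →ₗ[ℝ] L →ₗ[ℝ] ℝ
  /-- The complex structure. -/
  J : L →ₗ[ℝ] L
  /-- The Levi-Civita connection. -/
  conn : L →ₗ[ℝ] L →ₗ[ℝ] L
  metric_symm : ∀ u v, metric u v = metric v u
  metric_pos : ∀ u, u ≠ 0 → 0 < metric u u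
  J_sq : ∀ u, J (J u) = -u
  metric_J_self : ∀ u, metric (J u) u = 0
  closed : ∀ u v w, metric (J ⁅u, v⁆) w + metric (J ⁅v, w⁆) u + metric (J ⁅w, u⁆) v = 0
  conn_skew : ∀ u v w, metric (conn u v) w = -metric (conn u w) v
  conn_sub : ∀ u v, conn u v - conn v u = ⁅u, v⁆

namespace AlmostKahlerLieAlgebra

variable {L : Type*} [LieRing L] [LieAlgebra ℝ L] (A : AlmostKahlerLieAlgebra L)

/-- The endomorphism `w ↦ R(w,u)v`. -/
def curvatureEnd (u v : L) : L →ₗ[ℝ] L :=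
  A.conn.flip (A.conn u v) - A.conn u ∘ₗ A.conn.flip v + A.conn.flip v ∘ₗ LieAlgebra.ad ℝ L u

theorem curvatureEnd_apply (u v w : L) : A.curvatureEnd u v w
    = A.conn w (A.conn u v) - A.conn u (A.conn w v) - A.conn ⁅w, u⁆ v := by
  simp only [curvatureEnd, LinearMap.add_apply, LinearMap.sub_apply, LinearMap.comp_apply,
    LinearMap.flip_apply, LieAlgebra.ad_apply]
  rw [← lie_skew w u]
  simp only [map_neg, LinearMap.neg_apply, sub_neg_eq_add]

/-- The Ricci tensor. -/
def ricci (u v : L) : ℝ := LinearMap.trace ℝ L (A.curvatureEnd u v)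

/-- The Nijenhuis tensor. -/
def nijenhuis (u v : L) : L := ⁅A.J u, A.J v⁆ - A.J ⁅A.J u, v⁆ - A.J ⁅u, A.J v⁆ - ⁅u, v⁆

theorem nijenhuis_add_left (u u' v : L) :
    A.nijenhuis (u + u') v = A.nijenhuis u v + A.nijenhuis u' v := by
  simp only [nijenhuis, map_add, add_lie]
  abel

theorem nijenhuis_smul_left (c : ℝ) (u v : L) :
    A.nijenhuis (c • u) v = c • A.nijenhuis u v := by
  simp only [nijenhuis, map_smul, smul_lie, smul_sub]

theorem nijenhuis_swap (u v : L) : A.nijenhuis u v = -A.nijenhuis v u := by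
  simp only [nijenhuis]
  rw [← lie_skew (A.J u) (A.J v), ← lie_skew (A.J u) v, ← lie_skew u (A.J v), ← lie_skew u v]
  simp only [map_neg]
  abel

theorem nijenhuis_add_right (u v v' : L) :
    A.nijenhuis u (v + v') = A.nijenhuis u v + A.nijenhuis u v' := by
  simp only [nijenhuis, map_add, lie_add]
  abel

theorem nijenhuis_smul_right (c : ℝ) (u v : L) :
    A.nijenhuis u (c • v) = c • A.nijenhuis u v := by
  simp only [nijenhuis, map_smul, lie_smul, smul_sub]

theorem nijenhuis_J_left (u v : L) : A.nijenhuis (A.J u) v = -A.J (A.nijenhuis u v) := by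
  simp only [nijenhuis, map_sub, A.J_sq, neg_lie, map_neg]
  abel

theorem nijenhuis_J_right (u v : L) : A.nijenhuis u (A.J v) = -A.J (A.nijenhuis u v) := by
  rw [nijenhuis_swap, nijenhuis_J_left, A.nijenhuis_swap u v, map_neg]

theorem nijenhuis_self (u : L) : A.nijenhuis u u = 0 := by
  simp only [nijenhuis, lie_self]
  rw [← lie_skew u (A.J u), map_neg]
  abel

theorem metric_J_left (u v : L) : A.metric (A.J u) v = -A.metric u (A.J v) := by
  have h := A.metric_J_self (u + v)
  simp only [map_add, LinearMap.add_apply, A.metric_J_self] at h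
  rw [A.metric_symm u (A.J v)]
  linarith

theorem metric_J_J (u v : L) : A.metric (A.J u) (A.J v) = A.metric u v := by
  rw [metric_J_left, A.J_sq, map_neg, neg_neg]

/-- A unitary frame `e₀, e₁ = J e₀, e₂, e₃ = J e₂`. -/
structure IsUnitaryFrame (e : Fin 4 → L) : Prop where
  orthonormal : ∀ i j, A.metric (e i) (e j) = if i = j then 1 else 0
  J_zero : A.J (e 0) = e 1
  J_two : A.J (e 2) = e 3

variable {A}

theorem isUnitaryFrame_mk {u v : L} (hu : A.metric u u = 1) (hv : A.metric v v = 1)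
    (huv : A.metric u v = 0) (hJ : A.metric (A.J u) v = 0) :
    A.IsUnitaryFrame ![u, A.J u, v, A.J v] := by
  have hvu : A.metric v u = 0 := by rw [A.metric_symm, huv]
  have hJ' : A.metric v (A.J u) = 0 := by rw [A.metric_symm, hJ]
  have hJ'' : A.metric u (A.J v) = 0 := by linarith [A.metric_J_left u v]
  have hJ''' : A.metric (A.J v) u = 0 := by rw [A.metric_symm, hJ'']
  have hs (w : L) : A.metric w (A.J w) = 0 := by rw [A.metric_symm, A.metric_J_self]
  refine ⟨fun i j ↦ ?_, rfl, rfl⟩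
  fin_cases i <;> fin_cases j <;> simp [hu, hv, huv, hJ, hvu, hJ', hJ'', hJ''', hs, metric_J_J,
    A.metric_J_self]

namespace IsUnitaryFrame

variable {e : Fin 4 → L} (he : A.IsUnitaryFrame e)

include he

theorem J_one : A.J (e 1) = -e 0 := by rw [← he.J_zero, A.J_sq]

theorem J_three : A.J (e 3) = -e 2 := by rw [← he.J_two, A.J_sq]

theorem linearIndependent : LinearIndependent ℝ e := by
  rw [Fintype.linearIndependent_iff]
  intro g hg i
  have := congrArg (fun u ↦ A.metric u (e i)) hg
  simpa [he.orthonormal] using this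

theorem exists_basis (hL : Module.finrank ℝ L = 4) :
    ∃ b : Module.Basis (Fin 4) ℝ L, (∀ i, b i = e i) ∧ ∀ u i, b.repr u i = A.metric u (e i) := by
  let b := basisOfLinearIndependentOfCardEqFinrank he.linearIndependent (by simp [hL])
  have hb (i) : b i = e i := congrFun (coe_basisOfLinearIndependentOfCardEqFinrank _ _) i
  refine ⟨b, hb, fun u i ↦ ?_⟩
  conv_rhs => rw [← b.sum_repr u]
  simp [hb, he.orthonormal]

theorem sum_smul (hL : Module.finrank ℝ L = 4) (u : L) : ∑ i, A.metric u (e i) • e i = u := by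
  obtain ⟨b, hb, hr⟩ := he.exists_basis hL
  conv_rhs => rw [← b.sum_repr u]
  simp [hb, hr]

theorem metric_eq_sum (hL : Module.finrank ℝ L = 4) (u v : L) :
    A.metric u v = ∑ i, A.metric u (e i) * A.metric v (e i) := by
  conv_lhs => rw [← he.sum_smul hL v]
  simp [mul_comm]

theorem trace_eq (hL : Module.finrank ℝ L = 4) (f : L →ₗ[ℝ] L) :
    LinearMap.trace ℝ L f = ∑ i, A.metric (f (e i)) (e i) := by
  obtain ⟨b, hb, hr⟩ := he.exists_basis hL
  rw [LinearMap.trace_eq_matrix_trace ℝ b]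
  simp [Matrix.trace, LinearMap.toMatrix_apply, hr, hb]

end IsUnitaryFrame

variable (A) in
/-- The connection coefficients in a frame. -/
def coeff (e : Fin 4 → L) (i j k : Fin 4) : ℝ := A.metric (A.conn (e i) (e j)) (e k)

theorem coeff_skew (e : Fin 4 → L) (i j k : Fin 4) : A.coeff e i j k = -A.coeff e i k j :=
  A.conn_skew _ _ _

theorem metric_lie (e : Fin 4 → L) (i j k : Fin 4) :
    A.metric ⁅e i, e j⁆ (e k) = A.coeff e i j k - A.coeff e j i k := by
  rw [← A.conn_sub, map_sub, LinearMap.sub_apply]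
  rfl

namespace IsUnitaryFrame

variable {e : Fin 4 → L} (he : A.IsUnitaryFrame e) (hL : Module.finrank ℝ L = 4)

include he hL

theorem metric_lie_left (u : L) (k l : Fin 4) : A.metric ⁅u, e k⁆ (e l)
    = ∑ m, A.metric u (e m) * (A.coeff e m k l - A.coeff e k m l) := by
  conv_lhs => rw [← he.sum_smul hL u]
  simp only [sum_lie, smul_lie, map_sum, map_smul, LinearMap.sum_apply,
    LinearMap.smul_apply, metric_lie, smul_eq_mul]

theorem metric_conn_left (u : L) (k l : Fin 4) : A.metric (A.conn u (e k)) (e l)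
    = ∑ m, A.metric u (e m) * A.coeff e m k l := by
  conv_lhs => rw [← he.sum_smul hL u]
  simp only [map_sum, map_smul, LinearMap.sum_apply, LinearMap.smul_apply, smul_eq_mul, coeff]

theorem metric_conn_right (u : L) (k l : Fin 4) : A.metric (A.conn (e k) u) (e l)
    = ∑ m, A.metric u (e m) * A.coeff e k m l := by
  conv_lhs => rw [← he.sum_smul hL u]
  simp only [map_sum, map_smul, LinearMap.sum_apply, LinearMap.smul_apply, smul_eq_mul, coeff]

theorem frameJacobi_eq_zero (i j k l : Fin 4) : frameJacobi (A.coeff e) i j k l = 0 := by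
  have h : ⁅⁅e i, e j⁆, e k⁆ + ⁅⁅e j, e k⁆, e i⁆ + ⁅⁅e k, e i⁆, e j⁆ = 0 := by
    rw [← lie_skew ⁅e i, e j⁆, ← lie_skew ⁅e j, e k⁆, ← lie_skew ⁅e k, e i⁆, ← neg_add, ← neg_add,
      lie_jacobi, neg_zero]
  have h' := congrArg (fun u ↦ A.metric u (e l)) h
  simp only [map_add, LinearMap.add_apply, he.metric_lie_left hL ⁅_, _⁆, metric_lie, map_zero,
    LinearMap.zero_apply] at h'
  rw [frameJacobi, Finset.sum_add_distrib, Finset.sum_add_distrib, h']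

theorem ricci_eq (j k : Fin 4) : A.ricci (e j) (e k) = frameRicci (A.coeff e) j k := by
  rw [ricci, he.trace_eq hL]
  refine Finset.sum_congr rfl fun i _ ↦ ?_
  rw [curvatureEnd_apply]
  rw [map_sub, map_sub, LinearMap.sub_apply, LinearMap.sub_apply, he.metric_conn_right hL,
    he.metric_conn_right hL, he.metric_conn_left hL]
  simp only [metric_lie, Finset.sum_sub_distrib]
  rfl

end IsUnitaryFrame

end AlmostKahlerLieAlgebra

/-! ### Frames adapted to the Nijenhuis tensor. -/

namespace AlmostKahlerLieAlgebra

variable {L : Type*} [LieRing L] [LieAlgebra ℝ L] {A : AlmostKahlerLieAlgebra L}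

theorem IsUnitaryFrame.exists_coeff_eq {e : Fin 4 → L} (he : A.IsUnitaryFrame e)
    (hL : Module.finrank ℝ L = 4) (hric : ∀ u v, A.ricci (A.J u) (A.J v) = A.ricci u v)
    {t : ℝ} (ht : 0 < t) (hN : A.nijenhuis (e 0) (e 2) = (4 * t) • e 0) :
    ∃ y₁ y₂ : ℝ, 4 * (y₁ ^ 2 + y₂ ^ 2) = t ^ 2 ∧ A.coeff e
      = unitaryConnection ![0, 0, 2 * y₂, -2 * y₁] ![0, 0, -4 * y₂, 4 * y₁] 0 0 t := by
  have hJ := he.J_zero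
  have hJ₁ := he.J_one
  have hJ₂ := he.J_two
  have hJ₃ := he.J_three
  have cl (i j k) := A.closed (e i) (e j) (e k)
  have cl012 := cl 0 1 2
  have cl013 := cl 0 1 3
  have cl023 := cl 0 2 3
  have cl123 := cl 1 2 3
  have n (k) := congrArg (fun u ↦ A.metric u (e k)) hN
  have n0 := n 0
  have n1 := n 1
  have n2 := n 2
  have n3 := n 3
  simp only [nijenhuis, map_sub, map_smul, LinearMap.sub_apply, LinearMap.smul_apply, smul_eq_mul,
    metric_J_left, hJ, hJ₁, hJ₂, hJ₃, map_neg, he.orthonormal, reduceIte, Fin.isValue, Fin.reduceEq,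
    mul_zero, mul_one] at cl012 cl013 cl023 cl123 n0 n1 n2 n3
  have hΓ := eq_unitaryConnection (t := t) (coeff_skew (A := A) e)
    (c := fun i j k ↦ A.metric ⁅e i, e j⁆ (e k)) (metric_lie e) (by linarith) (by linarith)
    (by linarith) (by linarith) (by linarith) (by linarith) (by linarith) (by linarith)
  have hjac := he.frameJacobi_eq_zero hL
  have r (i j) := hric (e i) (e j)
  have r00 := r 0 0
  have r01 := r 0 1
  have r22 := r 2 2
  have r23 := r 2 3
  have r20 := r 2 0
  have r30 := r 3 0
  have neg_left (u v) : A.ricci (-u) v = -A.ricci u v := by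
    have : A.curvatureEnd (-u) v = -A.curvatureEnd u v := by
      ext w
      simp only [curvatureEnd_apply, LinearMap.neg_apply, map_neg, lie_neg]
      abel
    rw [ricci, this, map_neg, ricci]
  have neg_right (u v) : A.ricci u (-v) = -A.ricci u v := by
    have : A.curvatureEnd u (-v) = -A.curvatureEnd u v := by
      ext w
      simp only [curvatureEnd_apply, LinearMap.neg_apply, map_neg]
      abel
    rw [ricci, this, map_neg, ricci]
  simp only [hJ, hJ₁, hJ₂, hJ₃, neg_left, neg_right, he.ricci_eq hL] at r00 r01 r22 r23 r20 r30
  rw [hΓ] at hjac r00 r01 r22 r23 r20 r30 ⊢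
  exact exists_unitaryConnection_eq ht hjac r00 r01 r22 r23 r20 r30

theorem exists_unit_orthogonal {u : L} (hL : Module.finrank ℝ L = 4) :
    ∃ v, A.metric v v = 1 ∧ A.metric u v = 0 ∧ A.metric (A.J u) v = 0 := by
  have : FiniteDimensional ℝ L := Module.finite_of_finrank_eq_succ hL
  -- Two linear conditions on a 4-dimensional space have a nonzero common solution, which is then
  -- normalized.
  let F : L →ₗ[ℝ] ℝ × ℝ := (A.metric u).prod (A.metric (A.J u))
  have hF : LinearMap.ker F ≠ ⊥ := F.ker_ne_bot_of_finrank_lt (by simp [hL])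
  obtain ⟨w, hw, hw0⟩ := (Submodule.ne_bot_iff _).1 hF
  have hw' : A.metric u w = 0 ∧ A.metric (A.J u) w = 0 := by
    simpa [F] using hw
  have hpos := A.metric_pos w hw0
  refine ⟨(√(A.metric w w))⁻¹ • w, ?_, by simp [hw'.1], by simp [hw'.2]⟩
  simp only [map_smul, LinearMap.smul_apply, smul_eq_mul]
  rw [← mul_assoc, ← mul_inv, Real.mul_self_sqrt hpos.le, inv_mul_cancel₀ hpos.ne']

theorem exists_unit_smul {u : L} (hu : u ≠ 0) :
    ∃ r : ℝ, ∃ v, r ≠ 0 ∧ A.metric v v = 1 ∧ u = r • v := by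
  have hpos := A.metric_pos u hu
  have hs : √(A.metric u u) ≠ 0 := (Real.sqrt_pos.2 hpos).ne'
  refine ⟨√(A.metric u u), (√(A.metric u u))⁻¹ • u, hs, ?_, ?_⟩
  · simp only [map_smul, LinearMap.smul_apply, smul_eq_mul]
    rw [← mul_assoc, ← mul_inv, Real.mul_self_sqrt hpos.le, inv_mul_cancel₀ hpos.ne']
  · rw [smul_smul, mul_inv_cancel₀ hs, one_smul]

namespace IsUnitaryFrame

variable {e : Fin 4 → L} (he : A.IsUnitaryFrame e)

include he

/-- The frame obtained by rotating the two complex lines of a unitary frame. -/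
theorem rotate {l₁ l₂ z₁ z₂ : ℝ} (hl : l₁ ^ 2 + l₂ ^ 2 = 1) (hz : z₁ ^ 2 + z₂ ^ 2 = 1) :
    A.IsUnitaryFrame ![l₁ • e 0 + l₂ • e 1, A.J (l₁ • e 0 + l₂ • e 1),
      z₁ • e 2 + z₂ • e 3, A.J (z₁ • e 2 + z₂ • e 3)] := by
  apply isUnitaryFrame_mk <;>
    simp [he.orthonormal, he.J_zero, he.J_one] <;> linarith

/-- By conjugate-linearity in both arguments, the factors λ = l₁ + i l₂ and z = z₁ + i z₂ come out
as conj(λz). -/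
theorem nijenhuis_rotate (l₁ l₂ z₁ z₂ : ℝ) :
    A.nijenhuis (l₁ • e 0 + l₂ • e 1) (z₁ • e 2 + z₂ • e 3)
      = (l₁ * z₁ - l₂ * z₂) • A.nijenhuis (e 0) (e 2)
        - (l₁ * z₂ + l₂ * z₁) • A.J (A.nijenhuis (e 0) (e 2)) := by
  rw [← he.J_zero, ← he.J_two]
  simp only [nijenhuis_add_left, nijenhuis_add_right, nijenhuis_smul_left, nijenhuis_smul_right,
    nijenhuis_J_left, nijenhuis_J_right, A.J_sq, map_neg, map_add, map_smul]
  module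

/-- The image of the Nijenhuis tensor is the complex line of `N(e₀, e₂)`. -/
theorem exists_nijenhuis_eq (hL : Module.finrank ℝ L = 4) (u v : L) :
    ∃ p q : ℝ, A.nijenhuis u v
      = p • A.nijenhuis (e 0) (e 2) + q • A.J (A.nijenhuis (e 0) (e 2)) := by
  rw [← he.sum_smul hL u, ← he.sum_smul hL v]
  simp only [Fin.sum_univ_four, ← he.J_zero, ← he.J_two]
  generalize A.metric u (e 0) = a₀, A.metric u (A.J (e 0)) = a₁, A.metric u (e 2) = a₂,
    A.metric u (A.J (e 2)) = a₃, A.metric v (e 0) = b₀, A.metric v (A.J (e 0)) = b₁,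
    A.metric v (e 2) = b₂, A.metric v (A.J (e 2)) = b₃
  refine ⟨a₀ * b₂ - a₁ * b₃ - a₂ * b₀ + a₃ * b₁, -a₀ * b₃ - a₁ * b₂ + a₂ * b₁ + a₃ * b₀, ?_⟩
  simp only [nijenhuis_add_left, nijenhuis_add_right, nijenhuis_smul_left, nijenhuis_smul_right,
    nijenhuis_J_left, nijenhuis_J_right, A.J_sq, map_neg, map_add, map_smul, nijenhuis_self,
    A.nijenhuis_swap (e 2) (e 0), map_zero]
  module

end IsUnitaryFrame

/-- If e₀ spans the direction of a nonzero value of N, then N(e₀,e₂) lies in the complex line of e₀,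
since all values of N are complex multiples of it. Turning e₂ makes the coefficient positive. -/
theorem exists_adapted_frame (hL : Module.finrank ℝ L = 4) {u v : L} (hN : A.nijenhuis u v ≠ 0) :
    ∃ (e : Fin 4 → L) (t : ℝ), A.IsUnitaryFrame e ∧ 0 < t ∧
      A.nijenhuis (e 0) (e 2) = (4 * t) • e 0 := by
  obtain ⟨ρ, x, hρ, hx, hux⟩ := A.exists_unit_smul hN
  obtain ⟨y, hy, hxy, hJxy⟩ := A.exists_unit_orthogonal (u := x) hL
  obtain ⟨e, he, hx0⟩ : ∃ e, A.IsUnitaryFrame e ∧ e 0 = x :=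
    ⟨_, isUnitaryFrame_mk hx hy hxy hJxy, rfl⟩
  obtain ⟨p, q, hpq⟩ := he.exists_nijenhuis_eq hL u v
  rw [hux, ← hx0] at hpq
  have hs := he.sum_smul hL
  have ho := he.orthonormal
  have hJ₀ := he.J_zero
  have hJ₁ := he.J_one
  have hJ₂ := he.J_two
  have hJ₃ := he.J_three
  have hm := hs (A.nijenhuis (e 0) (e 2))
  rw [Fin.sum_univ_four] at hm
  generalize A.metric (A.nijenhuis (e 0) (e 2)) (e 0) = c,
    A.metric (A.nijenhuis (e 0) (e 2)) (e 1) = d, A.metric (A.nijenhuis (e 0) (e 2)) (e 2) = f,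
    A.metric (A.nijenhuis (e 0) (e 2)) (e 3) = g at hm
  rw [← hm] at hpq
  have k (i) := congrArg (fun u ↦ A.metric u (e i)) hpq
  have k0 := k 0
  have k1 := k 1
  have k2 := k 2
  have k3 := k 3
  simp [hJ₀, hJ₁, hJ₂, hJ₃, ho] at k0 k1 k2 k3
  have hpq0 : 0 < p ^ 2 + q ^ 2 := by
    by_contra! h
    have hp : p = 0 := by nlinarith [sq_nonneg p, sq_nonneg q]
    have hq : q = 0 := by nlinarith [sq_nonneg p, sq_nonneg q]
    exact hρ (by rw [k0, hp, hq]; ring)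
  have hf : f = 0 := by
    have : (p ^ 2 + q ^ 2) * f = 0 := by linear_combination (-p) * k2 - q * k3
    exact (mul_eq_zero.1 this).resolve_left hpq0.ne'
  have hg : g = 0 := by
    have : (p ^ 2 + q ^ 2) * g = 0 := by linear_combination q * k2 - p * k3
    exact (mul_eq_zero.1 this).resolve_left hpq0.ne'
  have hcd : 0 < c ^ 2 + d ^ 2 := by
    by_contra! h
    have hc : c = 0 := by nlinarith [sq_nonneg c, sq_nonneg d]
    have hd : d = 0 := by nlinarith [sq_nonneg c, sq_nonneg d]
    exact hρ (by rw [k0, hc, hd]; ring)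
  obtain ⟨s, hs0, hs2⟩ : ∃ s : ℝ, 0 < s ∧ s ^ 2 = c ^ 2 + d ^ 2 :=
    ⟨√(c ^ 2 + d ^ 2), Real.sqrt_pos.2 hcd, Real.sq_sqrt hcd.le⟩
  -- Here N(e₀,e₂) = (c + id) e₀. Turning e₂ by z = (c + id)/s multiplies it by conj(z), giving |c +
  -- id|²/s = s = 4t.
  refine ⟨_, s / 4, he.rotate (l₁ := 1) (l₂ := 0) (z₁ := c / s) (z₂ := d / s) (by norm_num)
    (by field_simp; linarith), by positivity, ?_⟩
  simp only [Matrix.cons_val_zero, Matrix.cons_val]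
  rw [he.nijenhuis_rotate, ← hm, hf, hg]
  simp only [map_add, map_smul, hJ₀, hJ₁, zero_smul, add_zero]
  have e1 : c / s * c + d / s * d = s := by field_simp; linarith
  match_scalars
  · linear_combination e1
  · ring

end AlmostKahlerLieAlgebra

/-! ### Normal form and identification with the model algebra. -/

namespace AlmostKahlerLieAlgebra

variable {L : Type*} [LieRing L] [LieAlgebra ℝ L] {A : AlmostKahlerLieAlgebra L}

theorem exists_normal_frame (hL : Module.finrank ℝ L = 4)
    (hric : ∀ u v, A.ricci (A.J u) (A.J v) = A.ricci u v) (hN : ∃ u v, A.nijenhuis u v ≠ 0) :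
    ∃ (e : Fin 4 → L) (r : ℝ), A.IsUnitaryFrame e ∧ 0 < r ∧ A.coeff e
      = unitaryConnection ![0, 0, 0, -2 * r] ![0, 0, 0, 4 * r] 0 0 (2 * r) := by
  obtain ⟨u, v, hN⟩ := hN
  obtain ⟨e, t, he, ht, hNe⟩ := exists_adapted_frame hL hN
  obtain ⟨y₁, y₂, hy, hΓ⟩ := he.exists_coeff_eq hL hric ht hNe
  obtain ⟨r, hr⟩ : ∃ r, r = t / 2 := ⟨_, rfl⟩
  have hr0 : 0 < r := by rw [hr]; positivity
  have hyr : y₁ ^ 2 + y₂ ^ 2 = r ^ 2 := by rw [hr]; linarith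
  obtain ⟨z₁, hz₁⟩ : ∃ z, z = y₁ / r := ⟨_, rfl⟩
  obtain ⟨z₂, hz₂⟩ : ∃ z, z = y₂ / r := ⟨_, rfl⟩
  have hy₁ : y₁ = r * z₁ := by rw [hz₁]; field_simp
  have hy₂ : y₂ = r * z₂ := by rw [hz₂]; field_simp
  have hz : z₁ ^ 2 + z₂ ^ 2 = 1 := by
    rw [hz₁, hz₂]
    field_simp
    exact hyr
  -- Turning e₂ by z = y/|y| and e₀ by λ keeps N(e₀,e₂) = 4t e₀ exactly when conj(λz) = λ, that is,
  -- λ² = conj(z) for |λ| = 1.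
  obtain ⟨w, hw⟩ := IsAlgClosed.exists_pow_nat_eq (⟨z₁, -z₂⟩ : ℂ) (n := 2) (by norm_num)
  have hl₁ : w.re ^ 2 - w.im ^ 2 = z₁ := by
    have := congrArg Complex.re hw
    simp only [pow_two, Complex.mul_re] at this
    linarith
  have hl₂ : 2 * w.re * w.im = -z₂ := by
    have := congrArg Complex.im hw
    simp only [pow_two, Complex.mul_im] at this
    linarith
  generalize w.re = l₁, w.im = l₂ at hl₁ hl₂
  have hl : l₁ ^ 2 + l₂ ^ 2 = 1 := by
    have : (l₁ ^ 2 + l₂ ^ 2) ^ 2 = 1 := by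
      rw [← hz, ← hl₁, show z₂ ^ 2 = (2 * l₁ * l₂) ^ 2 by rw [hl₂]; ring]
      ring
    nlinarith [sq_nonneg l₁, sq_nonneg l₂]
  have he' := he.rotate hl hz
  have hNe' : A.nijenhuis (l₁ • e 0 + l₂ • e 1) (z₁ • e 2 + z₂ • e 3)
      = (4 * t) • (l₁ • e 0 + l₂ • e 1) := by
    rw [he.nijenhuis_rotate, hNe, map_smul, he.J_zero]
    have h1 : l₁ * z₁ - l₂ * z₂ = l₁ := by
      linear_combination (-l₁) * hl₁ - l₂ * hl₂ + l₁ * hl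
    have h2 : l₁ * z₂ + l₂ * z₁ = -l₂ := by
      linear_combination (-l₂) * hl₁ + l₁ * hl₂ - l₂ * hl
    rw [h1, h2]
    module
  obtain ⟨x₁, x₂, -, hΓ'⟩ := he'.exists_coeff_eq hL hric ht hNe'
  -- The vector [e₂, Je₂] does not change when e₂ is turned. Its part in the complex line of e₂ is
  -- -4iy e₂, so comparing it in the two frames identifies the new y as |y| = r.
  have hlie : ⁅z₁ • e 2 + z₂ • e 3, A.J (z₁ • e 2 + z₂ • e 3)⁆ = ⁅e 2, e 3⁆ := by
    simp only [map_add, map_smul, he.J_two, he.J_three, add_lie, lie_add, smul_lie, lie_smul,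
      lie_self, lie_neg, smul_zero, zero_add, add_zero]
    rw [← lie_skew (e 3) (e 2)]
    match_scalars
    linarith
  have hJz : A.J (z₁ • e 2 + z₂ • e 3) = z₁ • e 3 - z₂ • e 2 := by
    simp only [map_add, map_smul, he.J_two, he.J_three]
    module
  have hk (k) := metric_lie (A := A) e 2 3 k
  have h2 := hk 2
  have h3 := hk 3
  have h2' := metric_lie (A := A) (![l₁ • e 0 + l₂ • e 1, A.J (l₁ • e 0 + l₂ • e 1),
      z₁ • e 2 + z₂ • e 3, A.J (z₁ • e 2 + z₂ • e 3)]) 2 3 2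
  have h3' := metric_lie (A := A) (![l₁ • e 0 + l₂ • e 1, A.J (l₁ • e 0 + l₂ • e 1),
      z₁ • e 2 + z₂ • e 3, A.J (z₁ • e 2 + z₂ • e 3)]) 2 3 3
  rw [hΓ] at h2 h3
  rw [hΓ'] at h2' h3'
  simp only [Matrix.cons_val, hlie] at h2' h3'
  rw [hJz] at h3'
  simp [unitaryConnection] at h2 h3 h2' h3'
  rw [h2, h3] at h2' h3'
  refine ⟨_, r, he', hr0, ?_⟩
  have hx₂ : x₂ = 0 := by
    rw [hy₁, hy₂] at h2'
    linarith
  have hx₁ : x₁ = r := by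
    rw [hy₁, hy₂] at h3'
    linear_combination (1 / 4) * h3' + r * hz
  rw [hΓ', hx₂, hx₁, hr]
  congr 1
  · simp
  · simp
  · ring

theorem exists_lieEquiv_vergneG49 (hL : Module.finrank ℝ L = 4)
    (hric : ∀ u v, A.ricci (A.J u) (A.J v) = A.ricci u v) (hN : ∃ u v, A.nijenhuis u v ≠ 0) :
    ∃ (φ : L ≃ₗ⁅ℝ⁆ VergneG49 (1 / 2)) (c : ℝ), 0 < c ∧
      ∀ u v, A.metric u v = c * VergneG49.h (φ u) (φ v) := by
  obtain ⟨e, r, he, hr, hΓ⟩ := exists_normal_frame hL hric hN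
  -- The model basis is f₁ = -e₂/4r, f₂ = e₀/4r, f₃ = e₃/4r, f₄ = e₁/4r. The factor 4r comes from
  -- [e₂,e₃] = -4r e₃, which must become [f₁,f₃] = f₃.
  let F : L → VergneG49 (1 / 2) := fun u ↦ (![-(4 * r * A.metric u (e 2)), 4 * r * A.metric u (e 0),
    4 * r * A.metric u (e 3), 4 * r * A.metric u (e 1)] : Fin 4 → ℝ)
  have F0 (u) : VergneG49.f 0 (F u) = -(4 * r * A.metric u (e 2)) := rfl
  have F1 (u) : VergneG49.f 1 (F u) = 4 * r * A.metric u (e 0) := rfl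
  have F2 (u) : VergneG49.f 2 (F u) = 4 * r * A.metric u (e 3) := rfl
  have F3 (u) : VergneG49.f 3 (F u) = 4 * r * A.metric u (e 1) := rfl
  have hlie (u v : L) (l) : A.metric ⁅u, v⁆ (e l)
      = ∑ k, A.metric v (e k) * ∑ m, A.metric u (e m) * (A.coeff e m k l - A.coeff e k m l) := by
    conv_lhs => rw [← he.sum_smul hL v]
    simp only [lie_sum, lie_smul, map_sum, map_smul, LinearMap.sum_apply, LinearMap.smul_apply,
      he.metric_lie_left hL, smul_eq_mul]
  let Φ : L →ₗ⁅ℝ⁆ VergneG49 (1 / 2) :=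
    { toFun := F
      map_add' := fun u v ↦ VergneG49.ext_f fun i ↦ by
        fin_cases i <;> simp [F0, F1, F2, F3] <;> ring
      map_smul' := fun c u ↦ VergneG49.ext_f fun i ↦ by
        fin_cases i <;> simp [F0, F1, F2, F3] <;> ring
      map_lie' := fun {u v} ↦ VergneG49.ext_f fun i ↦ by
        fin_cases i <;>
        simp [F0, F1, F2, F3, VergneG49.f_zero_lie, VergneG49.f_one_lie, VergneG49.f_two_lie,
          VergneG49.f_three_lie, hlie, hΓ, Fin.sum_univ_four, unitaryConnection] <;> ring }
  let Ψ : VergneG49 (1 / 2) → L := fun x ↦ (4 * r)⁻¹ • (VergneG49.f 1 x • e 0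
    + VergneG49.f 3 x • e 1 - VergneG49.f 0 x • e 2 + VergneG49.f 2 x • e 3)
  have hr' : r ≠ 0 := hr.ne'
  let φ : L ≃ₗ⁅ℝ⁆ VergneG49 (1 / 2) :=
    { Φ with
      invFun := Ψ
      left_inv := fun u ↦ by
        change Ψ (F u) = u
        conv_rhs => rw [← he.sum_smul hL u]
        simp only [Ψ, F0, F1, F2, F3, Fin.sum_univ_four]
        match_scalars <;> field_simp
      right_inv := fun x ↦ VergneG49.ext_f fun i ↦ by
        change VergneG49.f i (F (Ψ x)) = _
        fin_cases i <;> simp [F0, F1, F2, F3, Ψ, he.orthonormal] <;> field_simp }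
  refine ⟨φ, (16 * r ^ 2)⁻¹, by positivity, fun u v ↦ ?_⟩
  change _ = _ * VergneG49.h (F u) (F v)
  rw [he.metric_eq_sum hL, VergneG49.h]
  simp only [Fin.sum_univ_four, F0, F1, F2, F3]
  field_simp
  ring

end AlmostKahlerLieAlgebra

/-! ### Passage from the group to its Lie algebra. -/

section Group

variable {E : Type*} [NormedAddCommGroup E] [NormedSpace ℝ E]
  {H : Type*} [TopologicalSpace H] {I : ModelWithCorners ℝ E H}
  {G : Type*} [TopologicalSpace G] [ChartedSpace H G] [Group G] [LieGroup I ∞ G]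

theorem lieConnection_add_right (D : CovariantDerivative I E (TangentSpace I : G → Type _))
    (u v w : GroupLieAlgebra I G) :
    lieConnection D u (v + w) = lieConnection D u v + lieConnection D u w := by
  have hd (z : GroupLieAlgebra I G) :
      MDiffAt (T% (mulInvariantVectorField z : VField I G)) 1 :=
    (mulInvariantVectorField_isSmooth z 1).mdifferentiableAt (by simp)
  rw [lieConnection, mulInvariantVectorField_add,
    D.isCovariantDerivativeOnUniv.add (hd v) (hd w)]
  rfl

theorem lieConnection_smul_right (D : CovariantDerivative I E (TangentSpace I : G → Type _))
    (c : ℝ) (u v : GroupLieAlgebra I G) :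
    lieConnection D u (c • v) = c • lieConnection D u v := by
  have hd : MDiffAt (T% (mulInvariantVectorField v : VField I G)) 1 :=
    (mulInvariantVectorField_isSmooth v 1).mdifferentiableAt (by simp)
  rw [lieConnection, mulInvariantVectorField_smul,
    D.isCovariantDerivativeOnUniv.smul_const c hd]
  rfl

variable [FiniteDimensional ℝ E] [CompleteSpace E] {S : AlmostKahlerStructure I G}
  {D : CovariantDerivative I E (TangentSpace I : G → Type _)}

/-- The almost Kähler structure on the Lie algebra defined by a left-invariant almost Kähler
structure on the group. -/
def AlmostKahlerStructure.IsLeftInvariant.lieAlgebra (hS : S.IsLeftInvariant)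
    (hD : IsLeviCivita S.g D) : AlmostKahlerLieAlgebra (GroupLieAlgebra I G) where
  metric := LinearMap.mk₂ ℝ (fun u v ↦ S.g.inner 1 u v) (by simp) (by simp) (by simp) (by simp)
  J := (S.J 1 : GroupLieAlgebra I G →L[ℝ] GroupLieAlgebra I G)
  conn := LinearMap.mk₂ ℝ (lieConnection D) (fun _ _ _ ↦ map_add _ _ _) (fun _ _ _ ↦ map_smul _ _ _)
    (lieConnection_add_right D) (lieConnection_smul_right D)
  metric_symm := S.g.symm 1
  metric_pos := S.g.pos 1
  J_sq := S.J_sq 1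
  metric_J_self u := (S.compat 1 u u).symm.trans (S.alternating 1 u)
  closed := hS.closed_lie
  conn_skew u v w := by
    have := hS.leviCivita_skew hD 1 u v w
    simp only [mulInvariantVectorField_one] at this
    exact eq_neg_of_add_eq_zero_left this
  conn_sub u v := by
    have := hD.sub_mulInvariantVectorField 1 u v
    simp only [mulInvariantVectorField_one] at this
    exact this

theorem AlmostKahlerStructure.IsLeftInvariant.ricci_lieAlgebra (hS : S.IsLeftInvariant)
    (hD : IsLeviCivita S.g D) (u v : GroupLieAlgebra I G) :
    (hS.lieAlgebra hD).ricci u v = ricciTensor D 1 u v := by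
  -- The trace may be computed in any basis; this is the one used to define `ricciTensor`.
  let b : Module.Basis (Fin (Module.finrank ℝ E)) ℝ (GroupLieAlgebra I G) := Module.finBasis ℝ E
  refine (LinearMap.trace_eq_matrix_trace ℝ b _).trans (Finset.sum_congr rfl fun i _ ↦ ?_)
  rw [Matrix.diag_apply, LinearMap.toMatrix_apply, AlmostKahlerLieAlgebra.curvatureEnd_apply]
  exact congrArg (fun w ↦ b.repr w i) (hS.curvatureTensor_one hD (b i) u v).symm

end Group

end

theorem theorem2p2 {G : Type*} [TopologicalSpace G] [ChartedSpace (EuclideanSpace ℝ (Fin 4)) G]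
    [Group G] [LieGroup (𝓡 4) ∞ G]
    (S : AlmostKahlerStructure (𝓡 4) G) (hinv : S.IsLeftInvariant) (hstrict : S.IsStrict)
    (D : CovariantDerivative (𝓡 4) (EuclideanSpace ℝ (Fin 4))
      (TangentSpace (𝓡 4) : G → Type _))
    (hD : IsLeviCivita S.g D)
    (hric : ∀ (x : G) (u v : TangentSpace (𝓡 4) x),
      ricciTensor D x (S.J x u) (S.J x v) = ricciTensor D x u v) :
    ∃ (φ : GroupLieAlgebra (𝓡 4) G ≃ₗ⁅ℝ⁆ VergneG49 (1 / 2)) (c : ℝ), 0 < c ∧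
      ∀ (x : G) (X Y : GroupLieAlgebra (𝓡 4) G),
        S.g.inner x (mulInvariantVectorField X x) (mulInvariantVectorField Y x)
          = c * VergneG49.h (φ X) (φ Y) := by
  have hL : Module.finrank ℝ (GroupLieAlgebra (𝓡 4) G) = 4 :=
    finrank_euclideanSpace_fin (𝕜 := ℝ) (n := 4)
  obtain ⟨φ, c, hc, h⟩ := AlmostKahlerLieAlgebra.exists_lieEquiv_vergneG49
    (A := hinv.lieAlgebra hD) hL
    (fun u v ↦ by
      rw [hinv.ricci_lieAlgebra hD, hinv.ricci_lieAlgebra hD]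
      exact hric 1 u v)
    (hinv.exists_nijenhuis_ne_zero hstrict)
  refine ⟨φ, c, hc, fun x X Y ↦ ?_⟩
  rw [hinv.inner_mulInvariantVectorField]
  exact h X Y
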